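/- Let $N=\{1,\dots,n\}$ with $n\ge 2$ be a set of voters, partitioned into groups $N_1,\dots,N_g$, and let $P=\{p_1,\dots,p_m\}$ with $m\ge 1$ be a set of projects with the prior ordering $p_1\triangleleft\cdots\triangleleft p_m$. A preference is a complete linear order on $P$; write $\succ$ for its strict part, $\succ(1)$ for its top-ranked project (its peak), and $U(p,\succ)=\{p\}\cup\{p' : p'\succ p\}$. A preference is single-peaked if $p\succ p'$ whenever $\succ(1)\triangleleft p\triangleleft p'$ or $p'\triangleleft p\triangleleft \succ(1)$. Let $\mathcal D$ be the set of all single-peaked preferences and $\Delta P$ the set of probability distributions on $P$. A random social choice rule (RSCR) is a function $\varphi:\mathcal D^n\to\Delta P$; the probability $\varphi_p(\mathcal P)$ of $p$ at a profile $\mathcal P=(\succ_1,\dots,\succ_n)$ can be read as the budget share of $p$. The rule $\varphi$ is *unanimous* if $\varphi_p(\mathcal P)=1$ whenever $\succ_i(1)=p$ for all $i\in N$. It is *strategy-proof* if for every profile $\mathcal P\in\mathcal D^n$, every voter $i$ and every $\succ_i'\in\mathcal D$, the outcome at $\mathcal P$ stochastically dominates, with respect to $\succ_i$, the outcome at the profile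 $(\succ'_i,\succ_{-i})$, that is, for every $p\in P$ the set $U(p,\succ_i)$ has at least as much probability under $\varphi(\mathcal P)$ as under $\varphi(\succ'_i,\succ_{-i})$. It is *group-wise anonymous* if $\varphi(\succ_1,\dots,\succ_n)=\varphi(\succ_{\pi(1)},\dots,\succ_{\pi(n)})$ for every profile and every permutation $\pi$ of $N$ with $\pi(i)\in N_q$ for all $q$ and all $i\in N_q$. Let $\Gamma=\prod_{q=1}^g\{0,\dots,|N_q|\}$. For a profile $\mathcal P$ and $0\le t\le m$ let $\alpha(t;\mathcal P)\in\Gamma$ be the vector whose $q$-th entry is the number of voters in $N_q$ whose peak is one of $p_1,\dots,p_t$. Write $[p_1,p_t]=\{p_1,\dots,p_t\}$ (empty for $t=0$). The rule $\varphi$ is a *probabilistic fixed group ballot rule* if there are distributions $\delta_\gamma\in\Delta P$ $(\gamma\in\Gamma)$ such that 1. (ballot unanimity) $\delta_{(0,\dots,0)}(p_m)=1$ and $\delta_{(|N_1|,\dots,|N_g|)}(p_1)=1$; 2. (monotonicity) if $\gamma,\gamma'\in\Gamma$ and $\gamma_q\ge\gamma'_q$ for all $q$, then $\delta_\gamma([p_1,p_t])\ge\delta_{\gamma'}([p_1,p_t])$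 for all $t\in\{1,\dots,m\}$; 3. for all $\mathcal P\in\mathcal D^n$ and $t\in\{1,\dots,m\}$, $$\varphi_{p_t}(\mathcal P)=\delta_{\alpha(t;\mathcal P)}([p_1,p_t])-\delta_{\alpha(t-1;\mathcal P)}([p_1,p_{t-1}]),$$ where the subtracted term is $0$ for $t=1$. **Theorem.** An RSCR $\varphi:\mathcal D^n\to\Delta P$ is unanimous, strategy-proof and group-wise anonymous if and only if it is a probabilistic fixed group ballot rule. -/

import Mathlib

/-- A strictly ordinal preference (complete linear order) on the projects `p₁, …, pₘ`, which are
modelled by `Fin m` with its usual order as the prior ordering (the project `p_t` is the element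
of `Fin m` with value `t - 1`). `rel p p'` means that `p` is at least as good as `p'`. -/
structure Preference (m : ℕ) where
  rel : Fin m → Fin m → Prop
  refl : ∀ p, rel p p
  antisymm : ∀ p p', rel p p' → rel p' p → p = p'
  trans : ∀ p p' p'', rel p p' → rel p' p'' → rel p p''
  complete : ∀ p p', rel p p' ∨ rel p' p

namespace Preference

variable {m : ℕ}

/-- Strict preference `p ≻ p'`. -/
def StrictlyPrefers (r : Preference m) (p p' : Fin m) : Prop :=
  r.rel p p' ∧ p ≠ p'

/-- The upper contour set of `p`: the projects that are at least as good as `p`. -/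
noncomputable def upperContour (r : Preference m) (p : Fin m) : Finset (Fin m) := by
  classical
  exact Finset.univ.filter (fun p' => p' = p ∨ r.StrictlyPrefers p' p)

theorem exists_top [NeZero m] (r : Preference m) : ∃ p, ∀ p', r.rel p p' := by
  have key : ∀ s : Finset (Fin m), s.Nonempty → ∃ p ∈ s, ∀ p' ∈ s, r.rel p p' := by
    intro s hs
    induction hs using Finset.Nonempty.cons_induction with
    | singleton a => exact ⟨a, by simp, by simpa using r.refl a⟩
    | cons a s ha hs ih =>
      obtain ⟨p, hp, hmax⟩ := ih
      rcases r.complete a p with h | h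
      · refine ⟨a, by simp, fun p' hp' => ?_⟩
        rcases Finset.mem_cons.1 hp' with rfl | h'
        · exact r.refl _
        · exact r.trans _ _ _ h (hmax p' h')
      · refine ⟨p, by simp [hp], fun p' hp' => ?_⟩
        rcases Finset.mem_cons.1 hp' with rfl | h'
        · exact h
        · exact hmax p' h'
  obtain ⟨p, -, hp⟩ := key Finset.univ ⟨0, Finset.mem_univ _⟩
  exact ⟨p, fun p' => hp p' (Finset.mem_univ _)⟩

/-- The top-ranked project (the peak). -/
noncomputable def peak [NeZero m] (r : Preference m) : Fin m :=
  r.exists_top.choose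

theorem rel_peak [NeZero m] (r : Preference m) (p : Fin m) : r.rel r.peak p :=
  r.exists_top.choose_spec p

/-- Single-peakedness with respect to the prior ordering. -/
def SinglePeaked [NeZero m] (r : Preference m) : Prop :=
  ∀ p p' : Fin m, (r.peak < p ∧ p < p') ∨ (p' < p ∧ p < r.peak) → r.StrictlyPrefers p p'

end Preference

/-- The single-peaked domain: all single-peaked preferences on the projects. -/
def SPDomain (m : ℕ) [NeZero m] : Type :=
  {r : Preference m // r.SinglePeaked}

/-- A preference profile of `n` voters over the single-peaked domain. -/
abbrev Profile (n m : ℕ) [NeZero m] : Type :=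
  Fin n → SPDomain m

/-- Probability distributions over the projects. -/
abbrev Lottery (m : ℕ) : Type :=
  {δ : Fin m → ℝ // δ ∈ stdSimplex ℝ (Fin m)}

/-- The probability of a set of projects. -/
def Lottery.prob {m : ℕ} (δ : Lottery m) (A : Finset (Fin m)) : ℝ :=
  ∑ p ∈ A, δ.1 p

/-- The set `[p₁, p_t]`, i.e. the first `t` projects (the empty set for `t = 0`). -/
def firstProjects (m t : ℕ) : Finset (Fin m) :=
  Finset.univ.filter (fun p => p.val + 1 ≤ t)

/-- `δ` stochastically dominates `δ'` with respect to `r`. -/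
def StochDominates {m : ℕ} (r : Preference m) (δ δ' : Lottery m) : Prop :=
  ∀ p : Fin m, δ'.prob (r.upperContour p) ≤ δ.prob (r.upperContour p)

/-- Random social choice rules on the single-peaked domain. -/
abbrev RSCR (n m : ℕ) [NeZero m] : Type :=
  Profile n m → Lottery m

namespace RSCR

variable {n m g : ℕ} [NeZero m]

def Unanimous (φ : RSCR n m) : Prop :=
  ∀ (p : Fin m) (P : Profile n m), (∀ i, (P i).1.peak = p) → (φ P).1 p = 1

def StrategyProof (φ : RSCR n m) : Prop :=
  ∀ (i : Fin n) (P : Profile n m) (r' : SPDomain m),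
    StochDominates (P i).1 (φ P) (φ (Function.update P i r'))

/-- Group-wise anonymity for the groups `N q`. -/
def GroupwiseAnonymous (N : Fin g → Finset (Fin n)) (φ : RSCR n m) : Prop :=
  ∀ π : Equiv.Perm (Fin n), (∀ q, ∀ i ∈ N q, π i ∈ N q) →
    ∀ P : Profile n m, φ P = φ (fun i => P (π i))

end RSCR

/-- The set `Γ` of vectors `γ` with `γ_q ∈ {0, …, |N_q|}` for every group `q`.
The dominance order on `Γ` is the componentwise order. -/
abbrev BallotIndex {n g : ℕ} (N : Fin g → Finset (Fin n)) : Type :=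
  ∀ q : Fin g, Fin ((N q).card + 1)

/-- `α(t; P)`: for every group, the number of its voters whose peak is at or before `p_t`. -/
noncomputable def peakCount {n m g : ℕ} [NeZero m] (N : Fin g → Finset (Fin n))
    (t : ℕ) (P : Profile n m) : BallotIndex N :=
  fun q => ⟨((N q).filter (fun i => (P i).1.peak ∈ firstProjects m t)).card,
    Nat.lt_succ_of_le (Finset.card_filter_le _ _)⟩

/-- Ballot unanimity: the all-zero vector puts probability one on `pₘ`, the vector of the group
sizes puts probability one on `p₁`. -/
def BallotUnanimity {n m g : ℕ} [NeZero m] {N : Fin g → Finset (Fin n)}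
    (δ : BallotIndex N → Lottery m) : Prop :=
  (δ (fun _ => 0)).1 (⊤ : Fin m) = 1 ∧ (δ (fun q => Fin.last (N q).card)).1 (0 : Fin m) = 1

def BallotMonotonicity {n m g : ℕ} {N : Fin g → Finset (Fin n)}
    (δ : BallotIndex N → Lottery m) : Prop :=
  ∀ γ γ' : BallotIndex N, (∀ q, γ' q ≤ γ q) →
    ∀ t : ℕ, 1 ≤ t → t ≤ m →
      (δ γ').prob (firstProjects m t) ≤ (δ γ).prob (firstProjects m t)

/-- Probabilistic fixed group ballot rules. The project `p` is `p_t` with `t = p.val + 1`; for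
`t = 1` the subtracted term is the probability of the empty set, which is zero. -/
def RSCR.IsProbFixedGroupBallotRule {n m g : ℕ} [NeZero m] (N : Fin g → Finset (Fin n))
    (φ : RSCR n m) : Prop :=
  ∃ δ : BallotIndex N → Lottery m, BallotUnanimity δ ∧ BallotMonotonicity δ ∧
    ∀ (P : Profile n m) (p : Fin m),
      (φ P).1 p =
        (δ (peakCount N (p.val + 1) P)).prob (firstProjects m (p.val + 1))
          - (δ (peakCount N p.val P)).prob (firstProjects m p.val)

/-! Necessity rests on the fact that a unanimous strategy-proof rule sees only the peaks
(`update_eq_of_peak_eq`). Two single-peaked preferences with common peak `k` are joined by exchanges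
of consecutive projects `y`, `x` lying on opposite sides of `k`. Such an exchange by voter `i` can
only shift mass between `x` and `y`. The amount shifted is unaffected when another voter moves to a
preference sharing an upper set that contains exactly one of `x` and `y`, because strategy-proofness
freezes the mass of that set. Two such moves bring any voter to peak `k` (`exists_path`); there
unanimity forces the shift to be zero.

Once only peaks matter, a voter may be assumed to have an initial segment, or its complement, as an
upper set, so the mass of `[p₁, p_t]` is monotone in the set of voters with peaks there. Group-wise
anonymity reduces that set to its vector of group counts. The ballot `δ_γ` is the outcome when `γ_q`
voters of each group have peak `p₁` and all others `p_m`.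

For sufficiency, the formula telescopes to `φ([p₁, p_t]) = δ_{α(t)}([p₁, p_t])`. An upper contour
set is an interval containing the peak, hence a difference of two initial segments, and a misreport
can only lower the count for the larger and raise it for the smaller. -/

namespace Preference

variable {m : ℕ}

/-! ### Upper sets and adjacent disagreements -/

theorem ext_rel {r s : Preference m} (h : ∀ p q, r.rel p q ↔ s.rel p q) : r = s := by
  cases r; cases s
  congr
  funext p q
  exact propext (h p q)

theorem mem_upperContour (r : Preference m) (p q : Fin m) :
    q ∈ r.upperContour p ↔ r.rel q p := by
  classical
  unfold upperContour StrictlyPrefers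
  simp only [Finset.mem_filter, Finset.mem_univ, true_and]
  constructor
  · rintro (rfl | h)
    · exact r.refl _
    · exact h.1
  · intro h
    by_cases hq : q = p
    · exact Or.inl hq
    · exact Or.inr ⟨h, hq⟩

/-- `U` contains, with every project, all projects that are at least as good. -/
def IsUpper (r : Preference m) (U : Finset (Fin m)) : Prop :=
  ∀ p ∈ U, ∀ q, r.rel q p → q ∈ U

theorem isUpper_upperContour (r : Preference m) (p : Fin m) : r.IsUpper (r.upperContour p) := by
  intro q hq z hz
  rw [mem_upperContour] at *
  exact r.trans _ _ _ hz hq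

/-- The witness is the worst element of `U`. Strategy-proofness, stated for upper contour sets, thus
covers all upper sets. -/
theorem IsUpper.eq_upperContour {r : Preference m} {U : Finset (Fin m)} (hU : r.IsUpper U)
    (hne : U.Nonempty) : ∃ p, U = r.upperContour p := by
  have key : ∀ s : Finset (Fin m), s.Nonempty → ∃ p ∈ s, ∀ q ∈ s, r.rel q p := by
    intro s hs
    induction hs using Finset.Nonempty.cons_induction with
    | singleton a => exact ⟨a, by simp, by simpa using r.refl a⟩
    | cons a s ha hs ih =>
      obtain ⟨p, hp, hmin⟩ := ih
      rcases r.complete p a with h | h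
      · refine ⟨a, by simp, fun q hq => ?_⟩
        rcases Finset.mem_cons.1 hq with rfl | h'
        · exact r.refl _
        · exact r.trans _ _ _ (hmin q h') h
      · refine ⟨p, by simp [hp], fun q hq => ?_⟩
        rcases Finset.mem_cons.1 hq with rfl | h'
        · exact h
        · exact hmin q h'
  obtain ⟨p, hp, hmin⟩ := key U hne
  refine ⟨p, Finset.ext fun q => ?_⟩
  rw [mem_upperContour]
  exact ⟨hmin q, hU p hp q⟩

/-- If two preferences differ, some consecutive pair of the first one is ranked
in the opposite way by the second one. -/
theorem exists_adjacent_disagreement {r s : Preference m} (hne : r ≠ s) :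
    ∃ x y, x ≠ y ∧ r.rel y x ∧ s.rel x y ∧
      ∀ z, r.rel y z → r.rel z x → z = y ∨ z = x := by
  classical
  let T : Finset (Fin m × Fin m) :=
    Finset.univ.filter fun q => q.1 ≠ q.2 ∧ r.rel q.2 q.1 ∧ s.rel q.1 q.2
  have hT : T.Nonempty := by
    by_contra hT
    rw [Finset.not_nonempty_iff_eq_empty] at hT
    have h0 : ∀ a b, a ≠ b → r.rel b a → ¬ s.rel a b := by
      intro a b h1 h2 h3
      have : (a, b) ∈ T := by simp [T, h1, h2, h3]
      simp [hT] at this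
    apply hne
    apply ext_rel
    intro p q
    by_cases hpq : p = q
    · subst hpq
      exact ⟨fun _ => s.refl _, fun _ => r.refl _⟩
    · constructor
      · intro h
        exact (s.complete p q).resolve_right (h0 q p (Ne.symm hpq) h)
      · intro h
        exact (r.complete p q).resolve_right fun h' => h0 p q hpq h' h
  -- Take a disagreeing pair with the fewest projects between them in `r`. A project `z` strictly
  -- between would give a closer disagreeing pair, `(z, y)` or `(x, z)`.
  obtain ⟨⟨x, y⟩, hxy, hmin⟩ := T.exists_min_image
    (fun q => (Finset.univ.filter fun z => r.rel q.2 z ∧ r.rel z q.1).card) hT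
  simp only [T, Finset.mem_filter, Finset.mem_univ, true_and, Prod.forall] at hxy hmin
  obtain ⟨h1, h2, h3⟩ := hxy
  refine ⟨x, y, h1, h2, h3, fun z hyz hzx => ?_⟩
  by_contra hz
  push Not at hz
  rcases s.complete z y with h | h
  · refine absurd (hmin z y ⟨hz.1, hyz, h⟩) (not_le.2 (Finset.card_lt_card ?_))
    rw [Finset.ssubset_iff_of_subset]
    · refine ⟨x, by simp [h2, r.refl], fun hx => hz.2 ?_⟩
      simp only [Finset.mem_filter, Finset.mem_univ, true_and] at hx
      exact r.antisymm _ _ hzx hx.2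
    · intro w hw
      simp only [Finset.mem_filter, Finset.mem_univ, true_and] at hw ⊢
      exact ⟨hw.1, r.trans _ _ _ hw.2 hzx⟩
  · refine absurd (hmin x z ⟨hz.2.symm, hzx, s.trans _ _ _ h3 h⟩)
      (not_le.2 (Finset.card_lt_card ?_))
    rw [Finset.ssubset_iff_of_subset]
    · refine ⟨y, by simp [h2, r.refl], fun hx => hz.1 ?_⟩
      simp only [Finset.mem_filter, Finset.mem_univ, true_and] at hx
      exact r.antisymm _ _ hx.1 hyz
    · intro w hw
      simp only [Finset.mem_filter, Finset.mem_univ, true_and] at hw ⊢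
      exact ⟨r.trans _ _ _ hyz hw.1, hw.2⟩

/-- The preference that ranks projects by increasing cost. -/
def ofCost (c : Fin m → ℤ) (hc : Function.Injective c) : Preference m where
  rel p q := c p ≤ c q
  refl _ := le_rfl
  antisymm _ _ h h' := hc (le_antisymm h h')
  trans _ _ _ h h' := le_trans h h'
  complete _ _ := le_total _ _

/-! ### Single-peaked preferences and exchanges across the peak -/

variable [NeZero m]

theorem peak_eq_of_top (r : Preference m) {k : Fin m} (h : ∀ p, r.rel k p) : r.peak = k :=
  r.antisymm _ _ (r.rel_peak k) (h _)

theorem SinglePeaked.peak_lt_of_not_rel {r : Preference m} (hr : r.SinglePeaked) {p q : Fin m}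
    (hpq : p < q) (h : ¬ r.rel p q) : p < r.peak := by
  rcases lt_trichotomy p r.peak with h1 | h1 | h1
  · exact h1
  · exact absurd (h1 ▸ r.rel_peak q) h
  · exact absurd (hr p q (Or.inl ⟨h1, hpq⟩)).1 h

theorem SinglePeaked.lt_peak_of_not_rel {r : Preference m} (hr : r.SinglePeaked) {p q : Fin m}
    (hpq : q < p) (h : ¬ r.rel p q) : r.peak < p := by
  rcases lt_trichotomy p r.peak with h1 | h1 | h1
  · exact absurd (hr p q (Or.inr ⟨hpq, h1⟩)).1 h
  · exact absurd (h1 ▸ r.rel_peak q) h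
  · exact h1

/-- Upper sets of single-peaked preferences are intervals. -/
theorem SinglePeaked.ordConnected {r : Preference m} (hr : r.SinglePeaked)
    {U : Finset (Fin m)} (hU : r.IsUpper U) : (U : Set (Fin m)).OrdConnected := by
  refine ⟨fun a ha b hb c hc => ?_⟩
  obtain ⟨hac, hcb⟩ := hc
  rw [Finset.mem_coe] at *
  by_contra hcU
  have h1 : ¬ r.rel c a := fun h => hcU (hU a ha c h)
  have h2 : ¬ r.rel c b := fun h => hcU (hU b hb c h)
  have h3 : a < c := lt_of_le_of_ne hac fun h => hcU (h ▸ ha)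
  have h4 : c < b := lt_of_le_of_ne hcb fun h => hcU (h ▸ hb)
  exact lt_asymm (hr.peak_lt_of_not_rel h4 h2) (hr.lt_peak_of_not_rel h3 h1)

/-- `k` lies strictly between `x` and `y`. -/
def Separates (k x y : Fin m) : Prop := (x < k ∧ k < y) ∨ (y < k ∧ k < x)

/-- Single-peakedness fixes the ranking of two projects unless the peak lies strictly between them,
so preferences with the same peak disagree only across it. -/
theorem SinglePeaked.separates {r s : Preference m} (hr : r.SinglePeaked) (hs : s.SinglePeaked)
    (hpk : r.peak = s.peak) {x y : Fin m} (h1 : r.rel y x) (h2 : s.rel x y) (hne : x ≠ y) :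
    Separates r.peak x y := by
  have h1' : ¬ r.rel x y := fun h => hne (r.antisymm _ _ h h1)
  have h2' : ¬ s.rel y x := fun h => hne (s.antisymm _ _ h2 h)
  rcases lt_or_gt_of_ne hne with h | h
  · exact Or.inl ⟨hr.peak_lt_of_not_rel h h1', hpk ▸ hs.lt_peak_of_not_rel h h2'⟩
  · exact Or.inr ⟨hpk ▸ hs.peak_lt_of_not_rel h h2', hr.lt_peak_of_not_rel h h1'⟩

/-- The preference obtained by exchanging the consecutive projects `y ≻ x`. -/
def swapAdjacent (r : Preference m) (x y : Fin m) (hne : x ≠ y) (hyx : r.rel y x)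
    (hadj : ∀ z, r.rel y z → r.rel z x → z = y ∨ z = x) : Preference m where
  rel p q := (p = x ∧ q = y) ∨ (r.rel p q ∧ ¬ (p = y ∧ q = x))
  refl p := Or.inr ⟨r.refl p, fun h => hne (h.2 ▸ h.1)⟩
  antisymm p q h h' := by
    have := r.antisymm p q
    grind
  trans p q s h h' := by
    have h1 := r.trans p q s
    have h2 := r.complete
    have h3 := r.trans
    have h4 := r.antisymm
    have h5 := r.refl
    rcases h with ⟨rfl, rfl⟩ | ⟨h, hn⟩ <;> rcases h' with ⟨h6, rfl⟩ | ⟨h', hn'⟩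
    · exact absurd h6.symm hne
    · by_cases hs : s = q
      · exact Or.inl ⟨rfl, hs⟩
      · rcases h2 p s with h7 | h7
        · exact Or.inr ⟨h7, fun h => hne h.1⟩
        · rcases hadj s h' h7 with h8 | h8
          · exact absurd h8 hs
          · exact absurd ⟨rfl, h8⟩ hn'
    · subst h6
      by_cases hp : p = q
      · exact Or.inl ⟨hp, rfl⟩
      · rcases h2 p s with h7 | h7
        · exact Or.inr ⟨h7, fun h => hne h.2.symm⟩
        · rcases hadj p h7 h with h8 | h8
          · exact absurd ⟨h8, rfl⟩ hn
          · exact absurd h8 hp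
    · refine Or.inr ⟨h1 h h', ?_⟩
      rintro ⟨rfl, rfl⟩
      rcases hadj q h h' with h8 | h8
      · exact hn' ⟨h8, rfl⟩
      · exact hn ⟨rfl, h8⟩
  complete p q := by
    rcases r.complete p q with h | h <;> grind

section Swap

variable {r : Preference m} {x y : Fin m} {hne : x ≠ y} {hyx : r.rel y x}
    {hadj : ∀ z, r.rel y z → r.rel z x → z = y ∨ z = x}

theorem swapAdjacent_peak (hk : Separates r.peak x y) :
    (r.swapAdjacent x y hne hyx hadj).peak = r.peak := by
  refine peak_eq_of_top _ fun p => Or.inr ⟨r.rel_peak p, fun h => ?_⟩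
  rcases hk with hk | hk
  · exact absurd hk.2 (by rw [h.1]; exact lt_irrefl _)
  · exact absurd hk.1 (by rw [h.1]; exact lt_irrefl _)

/-- Single-peakedness constrains only pairs on one side of the peak, and the exchanged pair
straddles it. -/
theorem SinglePeaked.swapAdjacent (hr : r.SinglePeaked) (hk : Separates r.peak x y) :
    (r.swapAdjacent x y hne hyx hadj).SinglePeaked := by
  intro p q h
  rw [swapAdjacent_peak hk] at h
  have h1 := hr p q h
  refine ⟨Or.inr ⟨h1.1, ?_⟩, h1.2⟩
  rintro ⟨rfl, rfl⟩
  rcases hk with hk | hk <;> rcases h with h | h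
  · exact lt_asymm (h.1.trans h.2) hk.1
  · exact lt_asymm h.2 hk.2
  · exact lt_asymm h.1 hk.1
  · exact lt_asymm (h.1.trans h.2) hk.2

omit [NeZero m] in
theorem IsUpper.swapAdjacent {U : Finset (Fin m)} (hU : r.IsUpper U) (h : y ∈ U → x ∈ U) :
    (r.swapAdjacent x y hne hyx hadj).IsUpper U := by
  rintro p hp q (⟨rfl, rfl⟩ | ⟨hq, -⟩)
  · exact h hp
  · exact hU p hp q hq

end Swap

/-- Any two nested intervals around `k` are upper sets of a single-peaked preference
with peak `k`. -/
theorem exists_singlePeaked (k : Fin m) (I J : Finset (Fin m)) (hkI : k ∈ I) (hIJ : I ⊆ J)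
    (hI : (I : Set (Fin m)).OrdConnected) (hJ : (J : Set (Fin m)).OrdConnected) :
    ∃ r : SPDomain m, r.1.peak = k ∧ r.1.IsUpper I ∧ r.1.IsUpper J := by
  classical
  -- The base cost `b` alternates around `k`: even values to the right, odd to the left, all in `[0,
  -- 2m)`. Penalties of `2m` for leaving `I` and again for leaving `J` then rank `I` first, `J \ I`
  -- next and the rest last.
  let b : Fin m → ℤ := fun p => if k ≤ p then 2 * ((p : ℤ) - k) else 2 * ((k : ℤ) - p) - 1
  let c : Fin m → ℤ := fun p =>
    b p + ((if p ∈ I then 0 else 2 * (m : ℤ)) + (if p ∈ J then 0 else 2 * (m : ℤ)))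
  have hb0 : ∀ p, 0 ≤ b p := by
    intro p
    simp only [b, Fin.le_def]
    split_ifs <;> omega
  have hbm : ∀ p, b p < 2 * (m : ℤ) := by
    intro p
    have h1 := p.2
    have h2 := k.2
    simp only [b, Fin.le_def]
    split_ifs <;> omega
  have hbinj : ∀ p q, b p = b q → p = q := by
    intro p q h
    simp only [b, Fin.le_def] at h
    apply Fin.ext
    split_ifs at h <;> omega
  have hcinj : Function.Injective c := by
    intro p q h
    apply hbinj
    have h1 := hb0 p
    have h2 := hb0 q
    have h3 := hbm p
    have h4 := hbm q
    simp only [c] at h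
    split_ifs at h <;> omega
  have hmemI : ∀ p q, p ∈ I → (k < q ∧ q < p ∨ p < q ∧ q < k) → q ∈ I := by
    rintro p q hp (h | h)
    · exact hI.out hkI hp ⟨h.1.le, h.2.le⟩
    · exact hI.out hp hkI ⟨h.1.le, h.2.le⟩
  have hmemJ : ∀ p q, p ∈ J → (k < q ∧ q < p ∨ p < q ∧ q < k) → q ∈ J := by
    rintro p q hp (h | h)
    · exact hJ.out (hIJ hkI) hp ⟨h.1.le, h.2.le⟩
    · exact hJ.out hp (hIJ hkI) ⟨h.1.le, h.2.le⟩
  have hbk : b k = 0 := by simp [b]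
  have hck : c k = 0 := by simp [c, hbk, hkI, hIJ hkI]
  have hpk : (ofCost c hcinj).peak = k := by
    refine peak_eq_of_top _ fun p => ?_
    change c k ≤ c p
    rw [hck]
    have := hb0 p
    simp only [c]
    split_ifs <;> omega
  refine ⟨⟨ofCost c hcinj, ?_⟩, hpk, ?_, ?_⟩
  · intro p q h
    rw [hpk] at h
    refine ⟨?_, ?_⟩
    · change c p ≤ c q
      have h1 := hmemI q p
      have h2 := hmemJ q p
      have h3 : b p ≤ b q := by
        simp only [b, Fin.le_def]
        simp only [Fin.lt_def] at h
        split_ifs <;> omega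
      simp only [c]
      by_cases hqI : q ∈ I
      · have := h1 hqI h
        have := h2 (hIJ hqI) h
        simp only [hIJ hqI, *, if_true]
        omega
      · by_cases hqJ : q ∈ J
        · have := h2 hqJ h
          simp only [hqI, hqJ, this, if_true, if_false]
          split_ifs <;> omega
        · simp only [hqI, hqJ, if_false]
          split_ifs <;> omega
    · rintro rfl
      rcases h with h | h
      · exact lt_irrefl _ h.2
      · exact lt_irrefl _ h.1
  · intro p hp q hq
    change c q ≤ c p at hq
    by_contra hqI
    have h1 := hb0 q
    have h2 := hbm p
    simp only [c, hp, hIJ hp, hqI, if_true, if_false] at hq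
    split_ifs at hq <;> omega
  · intro p hp q hq
    change c q ≤ c p at hq
    by_contra hqJ
    have hqI : q ∉ I := fun h => hqJ (hIJ h)
    have h1 := hb0 q
    have h2 := hbm p
    simp only [c, hp, hqI, hqJ, if_true, if_false] at hq
    split_ifs at hq <;> omega

end Preference

/-! ### Probabilities of sets of projects -/

namespace Lottery

variable {m : ℕ}

theorem apply_nonneg (δ : Lottery m) (p : Fin m) : 0 ≤ δ.1 p := δ.2.1 p

theorem prob_univ (δ : Lottery m) : δ.prob Finset.univ = 1 := δ.2.2

theorem prob_mono (δ : Lottery m) {A B : Finset (Fin m)} (h : A ⊆ B) : δ.prob A ≤ δ.prob B :=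
  Finset.sum_le_sum_of_subset_of_nonneg h fun p _ _ => δ.apply_nonneg p

theorem prob_empty (δ : Lottery m) : δ.prob ∅ = 0 := Finset.sum_empty

theorem prob_sdiff (δ : Lottery m) {A B : Finset (Fin m)} (h : A ⊆ B) :
    δ.prob (B \ A) = δ.prob B - δ.prob A :=
  eq_sub_of_add_eq (Finset.sum_sdiff h)

theorem prob_compl (δ : Lottery m) (A : Finset (Fin m)) : δ.prob Aᶜ = 1 - δ.prob A := by
  rw [Finset.compl_eq_univ_sdiff, prob_sdiff _ (Finset.subset_univ _), prob_univ]

theorem prob_insert (δ : Lottery m) {A : Finset (Fin m)} {p : Fin m} (h : p ∉ A) :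
    δ.prob (insert p A) = δ.1 p + δ.prob A :=
  Finset.sum_insert h

theorem prob_singleton (δ : Lottery m) (p : Fin m) : δ.prob {p} = δ.1 p :=
  Finset.sum_singleton _ _

theorem prob_eq_one (δ : Lottery m) {A : Finset (Fin m)} {p : Fin m} (hp : p ∈ A)
    (h : δ.1 p = 1) : δ.prob A = 1 := by
  refine le_antisymm ?_ ?_
  · rw [← δ.prob_univ]
    exact δ.prob_mono (Finset.subset_univ _)
  · rw [← h, ← δ.prob_singleton]
    exact δ.prob_mono (by simpa using hp)

theorem prob_eq_zero (δ : Lottery m) {A : Finset (Fin m)} {p : Fin m} (hp : p ∉ A)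
    (h : δ.1 p = 1) : δ.prob A = 0 := by
  have h1 := δ.prob_eq_one (A := Aᶜ) (by simpa using hp) h
  rw [prob_compl] at h1
  linarith

/-- If two lotteries agree off `x` and `y`, the sets that contain `x` but not `y` carry the same
difference as `x` itself. -/
theorem prob_sub_prob (δ ε : Lottery m) {x y : Fin m} (h : ∀ z, z ≠ x → z ≠ y → δ.1 z = ε.1 z)
    {U : Finset (Fin m)} (hx : x ∈ U) (hy : y ∉ U) :
    δ.prob U - ε.prob U = δ.1 x - ε.1 x := by
  have h1 : δ.prob (U.erase x) = ε.prob (U.erase x) :=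
    Finset.sum_congr rfl fun z hz => h z (Finset.ne_of_mem_erase hz) fun e =>
      hy (e ▸ Finset.mem_of_mem_erase hz)
  have h2 : ∀ ζ : Lottery m, ζ.prob U = ζ.1 x + ζ.prob (U.erase x) := fun ζ =>
    (Finset.add_sum_erase _ _ hx).symm
  rw [h2, h2, h1]
  ring

end Lottery

/-! ### Initial segments and intervals -/

theorem mem_firstProjects {m t : ℕ} {p : Fin m} : p ∈ firstProjects m t ↔ p.val < t := by
  simp [firstProjects]

theorem firstProjects_zero (m : ℕ) : firstProjects m 0 = ∅ := by
  ext p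
  simp [mem_firstProjects]

theorem firstProjects_self (m : ℕ) : firstProjects m m = Finset.univ := by
  ext p
  simp [mem_firstProjects]

theorem firstProjects_mono {m s t : ℕ} (h : s ≤ t) : firstProjects m s ⊆ firstProjects m t := by
  intro p hp
  rw [mem_firstProjects] at *
  omega

theorem Lottery.prob_firstProjects_succ {m : ℕ} (δ : Lottery m) (p : Fin m) :
    δ.prob (firstProjects m (p.val + 1)) = δ.1 p + δ.prob (firstProjects m p.val) := by
  rw [← δ.prob_insert (by simp [mem_firstProjects])]
  congr 1
  ext q
  simp only [mem_firstProjects, Finset.mem_insert, Fin.ext_iff]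
  omega

/-- A nonempty interval of projects is a difference of two initial segments. -/
theorem exists_eq_firstProjects_sdiff {m : ℕ} {U : Finset (Fin m)}
    (hU : (U : Set (Fin m)).OrdConnected) (hne : U.Nonempty) :
    ∃ s t : ℕ, s ≤ t ∧ t ≤ m ∧ U = firstProjects m t \ firstProjects m s := by
  have h1 := U.min'_le_max' hne
  refine ⟨(U.min' hne).val, (U.max' hne).val + 1, ?_, ?_, ?_⟩
  · rw [Fin.le_def] at h1
    omega
  · exact (U.max' hne).2
  · ext p
    rw [Finset.mem_sdiff, mem_firstProjects, mem_firstProjects, Nat.lt_succ_iff, not_lt]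
    constructor
    · intro hp
      exact ⟨U.le_max' p hp, U.min'_le p hp⟩
    · intro hp
      exact hU.out (U.min'_mem hne) (U.max'_mem hne) ⟨hp.2, hp.1⟩

theorem firstProjects_ordConnected (m t : ℕ) :
    (firstProjects m t : Set (Fin m)).OrdConnected := by
  refine ⟨fun a _ b hb c hc => ?_⟩
  have h1 := hc.2
  simp only [Finset.mem_coe, mem_firstProjects, Fin.le_def] at *
  omega

theorem firstProjects_compl_ordConnected (m t : ℕ) :
    (((firstProjects m t)ᶜ : Finset (Fin m)) : Set (Fin m)).OrdConnected := by
  refine ⟨fun a ha b _ c hc => ?_⟩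
  have h1 := hc.1
  simp only [Finset.mem_coe, Finset.mem_compl, mem_firstProjects, Fin.le_def] at *
  omega

/-- A quantity that does not decrease under admissible changes of one coordinate does not decrease
when all coordinates are changed. -/
theorem le_of_forall_le_update {n : ℕ} {A : Type*} (G : (Fin n → A) → ℝ) (R : A → A → Prop)
    (h : ∀ P i s, R (P i) s → G P ≤ G (Function.update P i s)) (P P' : Fin n → A)
    (hR : ∀ i, R (P i) (P' i)) : G P ≤ G P' := by
  classical
  have key : ∀ S : Finset (Fin n), G P ≤ G (S.piecewise P' P) := by
    intro S
    induction S using Finset.induction_on with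
    | empty => simp
    | insert j S hj ih =>
      rw [Finset.piecewise_insert]
      refine ih.trans (h _ _ _ ?_)
      rw [Finset.piecewise_eq_of_notMem _ _ _ hj]
      exact hR j
  simpa using key Finset.univ

theorem SPDomain.exists_peak {m : ℕ} [NeZero m] (k : Fin m) : ∃ r : SPDomain m, r.1.peak = k := by
  obtain ⟨r, hr, -⟩ := Preference.exists_singlePeaked k Finset.univ Finset.univ (by simp) (by simp)
    (by simpa using Set.ordConnected_univ) (by simpa using Set.ordConnected_univ)
  exact ⟨r, hr⟩

/-! ### Moving a voter to a given peak through separating upper sets -/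

/-- The two preferences have a common upper set that contains exactly one of `x` and `y`. -/
def SharesSeparatingUpper {m : ℕ} [NeZero m] (x y : Fin m) (a b : SPDomain m) : Prop :=
  ∃ U, a.1.IsUpper U ∧ b.1.IsUpper U ∧ (x ∈ U ∧ y ∉ U ∨ y ∈ U ∧ x ∉ U)

namespace SharesSeparatingUpper

open Preference

variable {m : ℕ} [NeZero m]

/-- The upper contour set `U` of `x` separates `x` from `y` but may miss `k`. Adding the interval
`I` from `x` to `k` mends this and still avoids `y`, which lies beyond `k`. The intermediate
preference has peak `x` and both `U` and `U ∪ I` as upper sets. -/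
theorem exists_path_of_rel {k x y : Fin m} (hk : Separates k x y) (a : SPDomain m)
    (hxy : a.1.rel x y) :
    ∃ b c, c.1.peak = k ∧ SharesSeparatingUpper x y a b ∧ SharesSeparatingUpper x y b c := by
  have hne : x ≠ y := by
    rintro rfl
    rcases hk with hk | hk
    · exact lt_asymm hk.1 hk.2
    · exact lt_asymm hk.1 hk.2
  have hxU : x ∈ a.1.upperContour x := (mem_upperContour _ _ _).2 (a.1.refl x)
  have hyU : y ∉ a.1.upperContour x := fun h =>
    hne (a.1.antisymm _ _ hxy ((mem_upperContour _ _ _).1 h))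
  have hUo := a.2.ordConnected (a.1.isUpper_upperContour x)
  set U := a.1.upperContour x with hU
  let I := Finset.Icc (min x k) (max x k)
  have hxI : x ∈ I := by simp [I]
  have hkI : k ∈ I := by simp [I]
  have hyI : y ∉ I := by
    simp only [I, Finset.mem_Icc]
    rcases hk with hk | hk
    · rw [max_eq_right hk.1.le]
      exact fun h => absurd h.2 (not_le.2 hk.2)
    · rw [min_eq_right hk.2.le]
      exact fun h => absurd h.1 (not_le.2 hk.1)
  have hIo : (I : Set (Fin m)).OrdConnected := by
    simp only [I, Finset.coe_Icc]
    exact Set.ordConnected_Icc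
  -- The two intervals meet in `x`, so their union is an interval.
  have hVo : ((U ∪ I : Finset (Fin m)) : Set (Fin m)).OrdConnected := by
    refine ⟨fun p hp q hq z hz => ?_⟩
    simp only [Finset.coe_union, Set.mem_union, Finset.mem_coe] at *
    rcases le_total z x with h | h
    · rcases hp with hp | hp
      · exact Or.inl (hUo.out hp hxU ⟨hz.1, h⟩)
      · exact Or.inr (hIo.out hp hxI ⟨hz.1, h⟩)
    · rcases hq with hq | hq
      · exact Or.inl (hUo.out hxU hq ⟨h, hz.2⟩)
      · exact Or.inr (hIo.out hxI hq ⟨h, hz.2⟩)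
  have hV : x ∈ U ∪ I ∧ y ∉ U ∪ I := by simp [hxU, hyU, hyI]
  obtain ⟨b, -, hb1, hb2⟩ := exists_singlePeaked x U (U ∪ I) hxU Finset.subset_union_left hUo hVo
  obtain ⟨c, hc, hc1, -⟩ := exists_singlePeaked k (U ∪ I) (U ∪ I)
    (Finset.mem_union_right _ hkI) subset_rfl hVo hVo
  exact ⟨b, c, hc, ⟨U, a.1.isUpper_upperContour x, hb1, Or.inl ⟨hxU, hyU⟩⟩,
    ⟨U ∪ I, hb2, hc1, Or.inl hV⟩⟩

theorem exists_path {k x y : Fin m} (hk : Separates k x y) (a : SPDomain m) :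
    ∃ b c, c.1.peak = k ∧ SharesSeparatingUpper x y a b ∧ SharesSeparatingUpper x y b c := by
  rcases a.1.complete x y with h | h
  · exact exists_path_of_rel hk a h
  · obtain ⟨b, c, hc, ⟨U, h1, h2, h3⟩, ⟨V, h4, h5, h6⟩⟩ :=
      exists_path_of_rel (x := y) (y := x)
        (hk.elim (fun h => Or.inr ⟨h.1, h.2⟩) (fun h => Or.inl ⟨h.1, h.2⟩)) a h
    exact ⟨b, c, hc, ⟨U, h1, h2, h3.symm⟩, ⟨V, h4, h5, h6.symm⟩⟩

end SharesSeparatingUpper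

/-! ### Strategy-proofness and common upper sets -/

namespace RSCR

open Preference

variable {n m g : ℕ} [NeZero m] {φ : RSCR n m}

theorem StrategyProof.prob_le (hφ : φ.StrategyProof) (P : Profile n m) (i : Fin n)
    (s : SPDomain m) {U : Finset (Fin m)} (hU : (P i).1.IsUpper U) :
    (φ (Function.update P i s)).prob U ≤ (φ P).prob U := by
  rcases U.eq_empty_or_nonempty with rfl | hne
  · simp [Lottery.prob_empty]
  · obtain ⟨p, rfl⟩ := hU.eq_upperContour hne
    exact hφ i P s p

theorem StrategyProof.prob_update_le (hφ : φ.StrategyProof) (P : Profile n m) (i : Fin n)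
    (r s : SPDomain m) {U : Finset (Fin m)} (hU : r.1.IsUpper U) :
    (φ (Function.update P i s)).prob U ≤ (φ (Function.update P i r)).prob U := by
  simpa using hφ.prob_le (Function.update P i r) i s (U := U) (by simpa using hU)

/-- Neither report may gain from imitating the other, so a common upper set keeps its mass. -/
theorem StrategyProof.prob_update_eq (hφ : φ.StrategyProof) (P : Profile n m) (i : Fin n)
    {r s : SPDomain m} {U : Finset (Fin m)} (hr : r.1.IsUpper U) (hs : s.1.IsUpper U) :
    (φ (Function.update P i s)).prob U = (φ (Function.update P i r)).prob U :=
  le_antisymm (hφ.prob_update_le P i r s hr) (hφ.prob_update_le P i s r hs)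

theorem StrategyProof.prob_eq_update (hφ : φ.StrategyProof) (P : Profile n m) (i : Fin n)
    {s : SPDomain m} {U : Finset (Fin m)} (hr : (P i).1.IsUpper U) (hs : s.1.IsUpper U) :
    (φ P).prob U = (φ (Function.update P i s)).prob U := by
  simpa using hφ.prob_update_eq P i hs hr

section Swap

variable {r s : SPDomain m} {x y : Fin m}

/-- Exchanging two consecutive projects leaves the probabilities of the others unchanged. -/
theorem StrategyProof.apply_eq_of_swap (hφ : φ.StrategyProof)
    (hadj : ∀ z, r.1.rel y z → r.1.rel z x → z = y ∨ z = x)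
    (hup : ∀ U, r.1.IsUpper U → (y ∈ U → x ∈ U) → s.1.IsUpper U)
    (P : Profile n m) (i : Fin n) (z : Fin m) (hx : z ≠ x) (hy : z ≠ y) :
    (φ (Function.update P i r)).1 z = (φ (Function.update P i s)).1 z := by
  have hyx : r.1.rel y z → r.1.rel x z := by
    intro h
    rcases r.1.complete x z with h' | h'
    · exact h'
    · rcases hadj z h h' with h'' | h''
      · exact absurd h'' hy
      · exact absurd h'' hx
  have hU := r.1.isUpper_upperContour z
  have hz : z ∈ r.1.upperContour z := (mem_upperContour _ _ _).2 (r.1.refl z)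
  have hV : r.1.IsUpper ((r.1.upperContour z).erase z) := by
    intro p hp q hq
    rw [Finset.mem_erase] at *
    refine ⟨?_, hU p hp.2 q hq⟩
    rintro rfl
    exact hp.1 (r.1.antisymm _ _ ((mem_upperContour _ _ _).1 hp.2) hq)
  -- The mass of `z` is that of its upper contour set minus that of the same set without `z`.
  -- Neither set contains `y` without `x`, so both stay upper after the exchange.
  have h1 := hφ.prob_update_eq P i hU (hup _ hU (by simpa only [mem_upperContour] using hyx))
  have h2 := hφ.prob_update_eq P i hV (hup _ hV (by
    simp only [Finset.mem_erase, mem_upperContour]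
    exact fun h => ⟨hx.symm, hyx h.2⟩))
  rw [← Finset.insert_erase hz, Lottery.prob_insert _ (Finset.notMem_erase _ _),
    Lottery.prob_insert _ (Finset.notMem_erase _ _), h2] at h1
  linarith

/-- The shift at `x` equals the difference in mass of any set separating `x` from `y`, up to
complementation. For the shared upper set `U`, voter `j`'s move leaves both masses unchanged. -/
theorem StrategyProof.swap_difference_update (hφ : φ.StrategyProof) (i : Fin n)
    (hoff : ∀ (P : Profile n m) z, z ≠ x → z ≠ y →
      (φ (Function.update P i r)).1 z = (φ (Function.update P i s)).1 z)
    (P : Profile n m) (j : Fin n) (b : SPDomain m) (hb : SharesSeparatingUpper x y (P j) b) :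
    (φ (Function.update P i r)).1 x - (φ (Function.update P i s)).1 x =
      (φ (Function.update (Function.update P j b) i r)).1 x
        - (φ (Function.update (Function.update P j b) i s)).1 x := by
  by_cases hji : j = i
  · subst hji
    simp
  obtain ⟨U, h1, h2, h3⟩ := hb
  have hstep : ∀ a : SPDomain m, (φ (Function.update P i a)).prob U =
      (φ (Function.update (Function.update P j b) i a)).prob U := by
    intro a
    rw [Function.update_comm hji]
    exact hφ.prob_eq_update _ _ (by simpa [Function.update_of_ne hji] using h1) h2
  rcases h3 with ⟨hx, hy⟩ | ⟨hy, hx⟩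
  · rw [← Lottery.prob_sub_prob _ _ (hoff P) hx hy, ← Lottery.prob_sub_prob _ _ (hoff _) hx hy,
      hstep, hstep]
  · have hx' : x ∈ Uᶜ := by simpa using hx
    have hy' : y ∉ Uᶜ := by simpa using hy
    rw [← Lottery.prob_sub_prob _ _ (hoff P) hx' hy', ← Lottery.prob_sub_prob _ _ (hoff _) hx' hy']
    simp only [Lottery.prob_compl, hstep]

/-- The shift `D` survives moving all other voters to the peak of `r`. There unanimity puts all mass
on that peak under both reports, so `x` gets none and `D` vanishes. -/
theorem StrategyProof.update_eq_of_swap (hφ : φ.StrategyProof) (hun : φ.Unanimous)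
    (hk : Separates r.1.peak x y) (hpk : s.1.peak = r.1.peak)
    (hadj : ∀ z, r.1.rel y z → r.1.rel z x → z = y ∨ z = x)
    (hup : ∀ U, r.1.IsUpper U → (y ∈ U → x ∈ U) → s.1.IsUpper U)
    (P : Profile n m) (i : Fin n) :
    φ (Function.update P i r) = φ (Function.update P i s) := by
  have hoff := hφ.apply_eq_of_swap hadj hup (i := i)
  let D : Profile n m → ℝ := fun P =>
    (φ (Function.update P i r)).1 x - (φ (Function.update P i s)).1 x
  have hD : ∀ P P' : Profile n m, (∀ j, SharesSeparatingUpper x y (P j) (P' j)) → D P = D P' := by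
    intro P P' h
    -- The coordinatewise principle is one-sided, so it is applied to `D` and to `-D`.
    refine le_antisymm ?_ (neg_le_neg_iff.1 ?_)
    · exact le_of_forall_le_update D _
        (fun Q j b hb => (hφ.swap_difference_update i hoff Q j b hb).le) P P' h
    · exact le_of_forall_le_update (fun P => - D P) _
        (fun Q j b hb => (congrArg Neg.neg (hφ.swap_difference_update i hoff Q j b hb)).le) P P' h
  choose B C hC hB1 hB2 using fun a => SharesSeparatingUpper.exists_path hk a
  have h1 : D P = D (fun j => C (P j)) :=
    (hD P (fun j => B (P j)) fun j => hB1 _).trans (hD _ _ fun j => hB2 _)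
  have hxk : x ≠ r.1.peak := by
    rcases hk with hk | hk
    · exact hk.1.ne
    · exact hk.2.ne'
  have h2 : ∀ a : SPDomain m, a.1.peak = r.1.peak →
      (φ (Function.update (fun j => C (P j)) i a)).1 x = 0 := by
    intro a ha
    rw [← Lottery.prob_singleton]
    refine Lottery.prob_eq_zero _ (p := r.1.peak) (by simpa using hxk.symm) (hun _ _ fun j => ?_)
    by_cases hj : j = i
    · subst hj
      simpa using ha
    · simpa [Function.update_of_ne hj] using hC _
  have h3 : D P = 0 := by
    rw [h1]
    simp only [D, h2 r rfl, h2 s hpk, sub_self]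
  have hx : (φ (Function.update P i r)).1 x = (φ (Function.update P i s)).1 x := sub_eq_zero.1 h3
  have hother : ∀ z, z ≠ y → (φ (Function.update P i r)).1 z = (φ (Function.update P i s)).1 z := by
    intro z hz
    by_cases hzx : z = x
    · rw [hzx, hx]
    · exact hoff P z hzx hz
  have hy : (φ (Function.update P i r)).1 y = (φ (Function.update P i s)).1 y := by
    have e : (φ (Function.update P i r)).prob {y}ᶜ = (φ (Function.update P i s)).prob {y}ᶜ :=
      Finset.sum_congr rfl fun z hz => hother z (by simpa using hz)
    rw [Lottery.prob_compl, Lottery.prob_compl, Lottery.prob_singleton,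
      Lottery.prob_singleton] at e
    linarith
  refine Subtype.ext (funext fun z => ?_)
  by_cases hz : z = y
  · rw [hz, hy]
  · exact hother z hz

end Swap

/-! ### Dependence on peaks and monotonicity -/

/-- Unanimous strategy-proof rules depend on the peaks only. -/
theorem StrategyProof.update_eq_of_peak_eq (hφ : φ.StrategyProof) (hun : φ.Unanimous)
    (P : Profile n m) (i : Fin n) (r s : SPDomain m) (hpk : r.1.peak = s.1.peak) :
    φ (Function.update P i r) = φ (Function.update P i s) := by
  classical
  -- The number of pairs on which `r` and `s` disagree drops with each exchange.
  let c : SPDomain m → ℕ := fun r =>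
    (Finset.univ.filter fun q : Fin m × Fin m =>
      q.1 ≠ q.2 ∧ r.1.rel q.2 q.1 ∧ s.1.rel q.1 q.2).card
  induction hc : c r using Nat.strong_induction_on generalizing r with
  | _ N ih =>
    by_cases hrs : r = s
    · rw [hrs]
    have hrs' : r.1 ≠ s.1 := fun h => hrs (Subtype.ext h)
    obtain ⟨x, y, hne, h1, h2, hadj⟩ := exists_adjacent_disagreement hrs'
    have hk := r.2.separates s.2 hpk h1 h2 hne
    let r' : SPDomain m := ⟨r.1.swapAdjacent x y hne h1 hadj, r.2.swapAdjacent hk⟩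
    have hpk' : r'.1.peak = r.1.peak := swapAdjacent_peak (hne := hne) (hyx := h1) (hadj := hadj) hk
    rw [hφ.update_eq_of_swap hun hk hpk' hadj (fun U hU h => IsUpper.swapAdjacent (hne := hne) (hyx := h1)
      (hadj := hadj) hU h) P i]
    refine ih (c r') ?_ r' (hpk'.trans hpk) rfl
    rw [← hc]
    refine Finset.card_lt_card ?_
    rw [Finset.ssubset_iff_of_subset]
    · refine ⟨(x, y), by simp [hne, h1, h2], ?_⟩
      simp only [Finset.mem_filter, Finset.mem_univ, true_and, not_and]
      rintro - (⟨h, -⟩ | ⟨-, h⟩)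
      · exact absurd h.symm hne
      · exact absurd ⟨rfl, rfl⟩ h
    · rintro ⟨a, b⟩ hab
      simp only [Finset.mem_filter, Finset.mem_univ, true_and] at hab ⊢
      obtain ⟨h3, h4, h5⟩ := hab
      refine ⟨h3, ?_, h5⟩
      rcases h4 with ⟨rfl, rfl⟩ | ⟨h4, -⟩
      · exact absurd (s.1.antisymm _ _ h5 h2) h3
      · exact h4

/-- The probability of an initial segment grows with the set of voters whose peak it contains. -/
theorem StrategyProof.prob_firstProjects_le (hφ : φ.StrategyProof) (hun : φ.Unanimous) (t : ℕ)
    (P P' : Profile n m)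
    (h : ∀ i, (P i).1.peak ∈ firstProjects m t → (P' i).1.peak ∈ firstProjects m t) :
    (φ P).prob (firstProjects m t) ≤ (φ P').prob (firstProjects m t) := by
  refine le_of_forall_le_update (fun P => (φ P).prob (firstProjects m t))
    (fun a b => a.1.peak ∈ firstProjects m t → b.1.peak ∈ firstProjects m t) ?_ P P' h
  intro P i b hb
  by_cases hbt : b.1.peak ∈ firstProjects m t
  · obtain ⟨b', hpk, hup, -⟩ := exists_singlePeaked b.1.peak _ _ hbt subset_rfl
      (firstProjects_ordConnected m t) (firstProjects_ordConnected m t)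
    rw [hφ.update_eq_of_peak_eq hun P i b b' hpk.symm]
    simpa using hφ.prob_update_le P i b' (P i) hup
  -- Here both peaks lie outside the segment; the same argument applies to the old report and the
  -- complement.
  · have hat : (P i).1.peak ∈ (firstProjects m t)ᶜ := by
      simpa using fun h => hbt (hb h)
    obtain ⟨a', hpk, hup, -⟩ := exists_singlePeaked (P i).1.peak _ _ hat subset_rfl
      (firstProjects_compl_ordConnected m t) (firstProjects_compl_ordConnected m t)
    have h1 := hφ.update_eq_of_peak_eq hun P i (P i) a' hpk.symm
    rw [Function.update_eq_self] at h1
    rw [h1]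
    have h2 := hφ.prob_update_le P i a' b hup
    rw [Lottery.prob_compl, Lottery.prob_compl] at h2
    linarith

/-! ### Group-wise anonymity and reduction to counts -/

/-- If `B` has in every group at least as many elements as `A`, some permutation within the groups
maps `A` into `B`. -/
theorem exists_perm_mapsTo_of_card_le {g : ℕ} {N : Fin g → Finset (Fin n)}
    (hcover : ∀ i : Fin n, ∃ q, i ∈ N q)
    (hdisj : ∀ q q' : Fin g, q ≠ q' → Disjoint (N q) (N q')) (A B : Finset (Fin n))
    (h : ∀ q, ((N q).filter (· ∈ A)).card ≤ ((N q).filter (· ∈ B)).card) :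
    ∃ π : Equiv.Perm (Fin n), (∀ q, ∀ i ∈ N q, π i ∈ N q) ∧ ∀ i ∈ A, π i ∈ B := by
  induction hc : (A \ B).card using Nat.strong_induction_on generalizing A with
  | _ c ih =>
    by_cases hAB : A ⊆ B
    · exact ⟨1, fun _ _ hi => hi, fun i hi => hAB hi⟩
    obtain ⟨a, haA, haB⟩ := Finset.not_subset.1 hAB
    obtain ⟨q, haq⟩ := hcover a
    -- Counting in the group of `a` yields `b` in `B` but not in `A`; exchanging `a` and `b` removes
    -- `a` from `A \ B` and adds nothing.
    obtain ⟨b, hbq, hbB, hbA⟩ : ∃ b ∈ N q, b ∈ B ∧ b ∉ A := by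
      by_contra hcon
      push Not at hcon
      refine absurd (h q) (not_le.2 (Finset.card_lt_card ?_))
      rw [Finset.ssubset_iff_of_subset]
      · exact ⟨a, by simp [haq, haA], by simp [haB]⟩
      · intro i hi
        rw [Finset.mem_filter] at *
        exact ⟨hi.1, hcon i hi.1 hi.2⟩
    have hswap : ∀ q', ∀ i ∈ N q', Equiv.swap a b i ∈ N q' := by
      intro q' i hi
      have huniq : ∀ j, j ∈ N q → j ∈ N q' → q = q' := fun j h1 h2 => by
        by_contra hne
        exact Finset.disjoint_left.1 (hdisj q q' hne) h1 h2
      rw [Equiv.swap_apply_def]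
      split_ifs with h1 h2
      · subst h1
        exact huniq _ haq hi ▸ hbq
      · subst h2
        exact huniq _ hbq hi ▸ haq
      · exact hi
    let A' := A.map (Equiv.swap a b).toEmbedding
    have hA' : ∀ i, i ∈ A' ↔ Equiv.swap a b i ∈ A := by
      intro i
      simp only [A', Finset.mem_map_equiv, Equiv.symm_swap]
    have hlt : (A' \ B).card < c := by
      rw [← hc]
      refine Finset.card_lt_card ?_
      rw [Finset.ssubset_iff_of_subset]
      · refine ⟨a, by simp [haA, haB], ?_⟩
        rw [Finset.mem_sdiff, hA', Equiv.swap_apply_left]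
        exact fun h => hbA h.1
      · intro i hi
        rw [Finset.mem_sdiff, hA'] at hi
        have hib : i ≠ b := fun e => hi.2 (e ▸ hbB)
        have hia : i ≠ a := by
          rintro rfl
          exact hbA (by simpa using hi.1)
        rw [Equiv.swap_apply_of_ne_of_ne hia hib] at hi
        exact Finset.mem_sdiff.2 hi
    have hcard : ∀ q', ((N q').filter (· ∈ A')).card ≤ ((N q').filter (· ∈ A)).card := by
      intro q'
      refine Finset.card_le_card_of_injOn (Equiv.swap a b) ?_ (Equiv.injective _).injOn
      intro i hi
      simp only [Finset.coe_filter, Set.mem_ofPred_eq] at hi ⊢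
      exact ⟨hswap _ _ hi.1, (hA' i).1 hi.2⟩
    obtain ⟨π, h1, h2⟩ := ih _ hlt A' (fun q' => (hcard q').trans (h q')) rfl
    refine ⟨(Equiv.swap a b).trans π, fun q' i hi => h1 _ _ (hswap _ _ hi), fun i hi => ?_⟩
    exact h2 _ ((hA' _).2 (by simpa using hi))

/-- The probability of an initial segment grows with the numbers of voters in the groups whose
peak it contains. -/
theorem StrategyProof.prob_firstProjects_le_of_peakCount_le (hφ : φ.StrategyProof)
    (hun : φ.Unanimous) {N : Fin g → Finset (Fin n)} (han : φ.GroupwiseAnonymous N)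
    (hcover : ∀ i : Fin n, ∃ q, i ∈ N q)
    (hdisj : ∀ q q' : Fin g, q ≠ q' → Disjoint (N q) (N q')) (t : ℕ) (P P' : Profile n m)
    (h : ∀ q, peakCount N t P q ≤ peakCount N t P' q) :
    (φ P).prob (firstProjects m t) ≤ (φ P').prob (firstProjects m t) := by
  obtain ⟨π, h1, h2⟩ := exists_perm_mapsTo_of_card_le hcover hdisj
    (Finset.univ.filter fun i => (P i).1.peak ∈ firstProjects m t)
    (Finset.univ.filter fun i => (P' i).1.peak ∈ firstProjects m t) (by
      intro q
      have := h q
      rw [Fin.le_def] at this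
      simpa [peakCount] using this)
  rw [han π h1 P']
  refine hφ.prob_firstProjects_le hun t _ _ fun i hi => ?_
  simpa using h2 i (by simpa using hi)

theorem StrategyProof.prob_firstProjects_eq_of_peakCount_eq (hφ : φ.StrategyProof)
    (hun : φ.Unanimous) {N : Fin g → Finset (Fin n)} (han : φ.GroupwiseAnonymous N)
    (hcover : ∀ i : Fin n, ∃ q, i ∈ N q)
    (hdisj : ∀ q q' : Fin g, q ≠ q' → Disjoint (N q) (N q')) (t : ℕ) (P P' : Profile n m)
    (h : peakCount N t P = peakCount N t P') :
    (φ P).prob (firstProjects m t) = (φ P').prob (firstProjects m t) :=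
  le_antisymm
    (hφ.prob_firstProjects_le_of_peakCount_le hun han hcover hdisj t P P' fun q => by rw [h])
    (hφ.prob_firstProjects_le_of_peakCount_le hun han hcover hdisj t P' P fun q => by rw [h])

/-! ### Ballots from extreme profiles -/

/-- Every vector of the index set arises from a profile all of whose peaks are extreme. -/
theorem exists_extreme_profile (n m g : ℕ) [NeZero m] (N : Fin g → Finset (Fin n))
    (hcover : ∀ i : Fin n, ∃ q, i ∈ N q)
    (hdisj : ∀ q q' : Fin g, q ≠ q' → Disjoint (N q) (N q')) (γ : BallotIndex N) :
    ∃ P : Profile n m, ((∀ q, γ q = 0) → ∀ i, (P i).1.peak = ⊤) ∧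
      ((∀ q, γ q = Fin.last (N q).card) → ∀ i, (P i).1.peak = 0) ∧
      ∀ t, 1 ≤ t → t < m → peakCount N t P = γ := by
  classical
  obtain ⟨a, ha⟩ := SPDomain.exists_peak (0 : Fin m)
  obtain ⟨b, hb⟩ := SPDomain.exists_peak (⊤ : Fin m)
  -- The voters in the sets `T q` get peak `p₁`, all others `p_m`.
  have hT : ∀ q, ∃ T ⊆ N q, T.card = (γ q).val := fun q =>
    Finset.exists_subset_card_eq (Nat.lt_succ_iff.1 (γ q).2)
  choose T hTN hTc using hT
  refine ⟨fun i => if ∃ q, i ∈ T q then a else b, fun h i => ?_, fun h i => ?_,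
    fun t h1 h2 => ?_⟩
  · have : ¬ ∃ q, i ∈ T q := by
      rintro ⟨q, hq⟩
      have hc := hTc q
      rw [h q, Fin.val_zero, Finset.card_eq_zero] at hc
      simp [hc] at hq
    change (if ∃ q, i ∈ T q then a else b).1.peak = ⊤
    rw [if_neg this, hb]
  · obtain ⟨q, hq⟩ := hcover i
    have hc := hTc q
    rw [h q, Fin.val_last] at hc
    change (if ∃ q, i ∈ T q then a else b).1.peak = 0
    rw [if_pos ⟨q, (Finset.eq_of_subset_of_card_le (hTN q) hc.ge).symm ▸ hq⟩, ha]
  · funext q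
    apply Fin.ext
    simp only [peakCount]
    rw [← hTc q]
    congr 1
    ext i
    have hmem : (if ∃ q, i ∈ T q then a else b).1.peak ∈ firstProjects m t ↔ ∃ q, i ∈ T q := by
      split_ifs with h
      · rw [ha, mem_firstProjects]
        simp only [h, iff_true, Fin.val_zero]
        omega
      · rw [hb, mem_firstProjects]
        have : (⊤ : Fin m).val = m - 1 := by simp
        simp only [h, iff_false, this]
        omega
    rw [Finset.mem_filter, hmem]
    constructor
    · rintro ⟨hi, q', hq'⟩
      by_cases hqq : q = q'
      · exact hqq ▸ hq'
      · exact absurd (hTN q' hq') (Finset.disjoint_left.1 (hdisj q q' hqq) hi)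
    · exact fun hi => ⟨hTN q hi, q, hi⟩

theorem isProbFixedGroupBallotRule_of_strategyProof {N : Fin g → Finset (Fin n)}
    (hcover : ∀ i : Fin n, ∃ q, i ∈ N q)
    (hdisj : ∀ q q' : Fin g, q ≠ q' → Disjoint (N q) (N q'))
    (hun : φ.Unanimous) (hφ : φ.StrategyProof) (han : φ.GroupwiseAnonymous N) :
    φ.IsProbFixedGroupBallotRule N := by
  choose E hE0 hE1 hEt using exists_extreme_profile n m g N hcover hdisj
  have hF : ∀ (P : Profile n m) t, t ≤ m →
      (φ P).prob (firstProjects m t) = (φ (E (peakCount N t P))).prob (firstProjects m t) := by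
    intro P t ht
    -- The extreme profile need not have the prescribed counts at `t = 0` and `t = m`, but there
    -- every lottery gives mass `0` and `1`.
    rcases Nat.eq_zero_or_pos t with rfl | h0
    · simp [firstProjects_zero, Lottery.prob_empty]
    rcases ht.eq_or_lt with rfl | h1
    · simp [firstProjects_self, Lottery.prob_univ]
    · exact hφ.prob_firstProjects_eq_of_peakCount_eq hun han hcover hdisj t _ _
        (hEt _ t h0 h1).symm
  refine ⟨fun γ => φ (E γ), ⟨?_, ?_⟩, ?_, fun P p => ?_⟩
  · exact hun _ _ (hE0 _ fun _ => rfl)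
  · exact hun _ _ (hE1 _ fun _ => rfl)
  · intro γ γ' hγ t h0 h1
    rcases h1.eq_or_lt with rfl | h1
    · simp [firstProjects_self, Lottery.prob_univ]
    · refine hφ.prob_firstProjects_le_of_peakCount_le hun han hcover hdisj t _ _ fun q => ?_
      rw [hEt _ t h0 h1, hEt _ t h0 h1]
      exact hγ q
  · rw [← hF P _ p.2, ← hF P _ p.2.le, Lottery.prob_firstProjects_succ]
    ring

/-! ### Ballot rules satisfy the axioms -/

section BallotRule

variable {N : Fin g → Finset (Fin n)} {δ : BallotIndex N → Lottery m}

theorem prob_firstProjects_eq_ballot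
    (h : ∀ (P : Profile n m) (p : Fin m), (φ P).1 p =
      (δ (peakCount N (p.val + 1) P)).prob (firstProjects m (p.val + 1))
        - (δ (peakCount N p.val P)).prob (firstProjects m p.val))
    (P : Profile n m) (t : ℕ) (ht : t ≤ m) :
    (φ P).prob (firstProjects m t) = (δ (peakCount N t P)).prob (firstProjects m t) := by
  induction t with
  | zero => simp [firstProjects_zero, Lottery.prob_empty]
  | succ t ih =>
    have h1 := (φ P).prob_firstProjects_succ ⟨t, ht⟩
    have h2 := h P ⟨t, ht⟩
    have h3 := ih (Nat.le_of_succ_le ht)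
    dsimp only at h1 h2
    linarith

theorem unanimous_of_ballot (hδ : BallotUnanimity δ)
    (h : ∀ (P : Profile n m) t, t ≤ m →
      (φ P).prob (firstProjects m t) = (δ (peakCount N t P)).prob (firstProjects m t)) :
    φ.Unanimous := by
  intro p P hP
  have h1 : peakCount N (p.val + 1) P = fun q => Fin.last (N q).card := by
    funext q
    apply Fin.ext
    simp [peakCount, hP, mem_firstProjects]
  have h2 : peakCount N p.val P = fun _ => 0 := by
    funext q
    apply Fin.ext
    simp [peakCount, hP, mem_firstProjects]
  have h3 := (φ P).prob_firstProjects_succ p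
  have hp : (⊤ : Fin m) ∉ firstProjects m p.val := by
    rw [mem_firstProjects, ← Fin.lt_def]
    exact not_lt.2 le_top
  rw [h P _ p.2, h P _ p.2.le, h1, h2, Lottery.prob_eq_one _ (by simp [mem_firstProjects]) hδ.2,
    Lottery.prob_eq_zero _ hp hδ.1] at h3
  linarith

theorem peakCount_comp_perm (π : Equiv.Perm (Fin n)) (hπ : ∀ q, ∀ i ∈ N q, π i ∈ N q) (t : ℕ)
    (P : Profile n m) : peakCount N t (fun i => P (π i)) = peakCount N t P := by
  funext q
  apply Fin.ext
  -- An injection of a finite set into itself is onto.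
  have hmap : (N q).map π.toEmbedding = N q := by
    refine Finset.eq_of_subset_of_card_le ?_ (by simp)
    intro i hi
    obtain ⟨j, hj, rfl⟩ := Finset.mem_map.1 hi
    exact hπ q j hj
  simp only [peakCount]
  conv_rhs => rw [← hmap, Finset.filter_map, Finset.card_map]
  rfl

theorem peakCount_update_le (P : Profile n m) (i : Fin n) (s : SPDomain m) (t : ℕ)
    (h : s.1.peak ∈ firstProjects m t → (P i).1.peak ∈ firstProjects m t) (q : Fin g) :
    peakCount N t (Function.update P i s) q ≤ peakCount N t P q := by
  rw [Fin.le_def]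
  refine Finset.card_le_card fun j hj => ?_
  rw [Finset.mem_filter] at *
  refine ⟨hj.1, ?_⟩
  by_cases hji : j = i
  · subst hji
    exact h (by simpa using hj.2)
  · simpa [Function.update_of_ne hji] using hj.2

theorem le_peakCount_update (P : Profile n m) (i : Fin n) (s : SPDomain m) (t : ℕ)
    (h : (P i).1.peak ∈ firstProjects m t → s.1.peak ∈ firstProjects m t) (q : Fin g) :
    peakCount N t P q ≤ peakCount N t (Function.update P i s) q := by
  simpa using peakCount_update_le (N := N) (Function.update P i s) i (P i) t (by simpa using h) q

/-- The true peak lies in the segment up to `b` and outside the one up to `a`, so a deviation cannot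
raise the count at `b` or lower it at `a`. Monotonicity of the ballots then bounds the mass of the
interval between. -/
theorem strategyProof_of_ballot (hδ : BallotMonotonicity δ)
    (h : ∀ (P : Profile n m) t, t ≤ m →
      (φ P).prob (firstProjects m t) = (δ (peakCount N t P)).prob (firstProjects m t)) :
    φ.StrategyProof := by
  intro i P s p
  have hU := (P i).1.isUpper_upperContour p
  have hpk : (P i).1.peak ∈ (P i).1.upperContour p :=
    (mem_upperContour _ _ _).2 ((P i).1.rel_peak p)
  obtain ⟨a, b, hab, hbm, hUab⟩ :=
    exists_eq_firstProjects_sdiff ((P i).2.ordConnected hU) ⟨_, hpk⟩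
  rw [hUab, Finset.mem_sdiff] at hpk
  have hb0 : 1 ≤ b := by
    have := mem_firstProjects.1 hpk.1
    omega
  have h1 : (φ (Function.update P i s)).prob (firstProjects m b)
      ≤ (φ P).prob (firstProjects m b) := by
    rw [h _ _ hbm, h _ _ hbm]
    exact hδ _ _ (peakCount_update_le P i s b fun _ => hpk.1) b hb0 hbm
  have h2 : (φ P).prob (firstProjects m a)
      ≤ (φ (Function.update P i s)).prob (firstProjects m a) := by
    rcases Nat.eq_zero_or_pos a with rfl | ha
    · simp [firstProjects_zero, Lottery.prob_empty]
    rw [h _ _ (hab.trans hbm), h _ _ (hab.trans hbm)]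
    exact hδ _ _ (le_peakCount_update P i s a fun h => absurd h hpk.2) a ha (hab.trans hbm)
  rw [hUab, Lottery.prob_sdiff _ (firstProjects_mono hab),
    Lottery.prob_sdiff _ (firstProjects_mono hab)]
  linarith

theorem groupwiseAnonymous_of_ballot
    (h : ∀ (P : Profile n m) (p : Fin m), (φ P).1 p =
      (δ (peakCount N (p.val + 1) P)).prob (firstProjects m (p.val + 1))
        - (δ (peakCount N p.val P)).prob (firstProjects m p.val)) :
    φ.GroupwiseAnonymous N := by
  intro π hπ P
  refine Subtype.ext (funext fun p => ?_)
  rw [h, h, peakCount_comp_perm π hπ, peakCount_comp_perm π hπ]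

end BallotRule

end RSCR

theorem mainTheorem1 (n m g : ℕ) [NeZero m] (hn : 2 ≤ n)
    (N : Fin g → Finset (Fin n))
    (hcover : ∀ i : Fin n, ∃ q, i ∈ N q)
    (hdisj : ∀ q q' : Fin g, q ≠ q' → Disjoint (N q) (N q'))
    (φ : RSCR n m) :
    (φ.Unanimous ∧ φ.StrategyProof ∧ φ.GroupwiseAnonymous N) ↔
      φ.IsProbFixedGroupBallotRule N := by
  constructor
  · rintro ⟨hun, hsp, han⟩
    exact RSCR.isProbFixedGroupBallotRule_of_strategyProof hcover hdisj hun hsp han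
  · rintro ⟨δ, hu, hmon, h⟩
    have hF := RSCR.prob_firstProjects_eq_ballot h
    exact ⟨RSCR.unanimous_of_ballot hu hF, RSCR.strategyProof_of_ballot hmon hF,
      RSCR.groupwiseAnonymous_of_ballot h⟩
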